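/- Let $N\in\mathbb N$, let $f_1,\dots,f_N\colon[0,1]\to[0,1]$ and $g_1,\dots,g_N\colon[0,1]\to\mathbb R$ be Lebesgue measurable functions, and let $\|\cdot\|$ be the norm of $L^1([0,1])$. A number $l$ is the approximate derivative $h'(x_0)$ of $h\colon[0,1]\to\mathbb R$ at $x_0$ if for every $\varepsilon>0$ the set $\{x\in[0,1]\setminus\{x_0\}:|h(x)-h(x_0)-l(x-x_0)|<\varepsilon|x-x_0|\}$ has $x_0$ as a Lebesgue density point; where no such $l$ exists, put $h'(x_0)=0$. Assume: (H1) each $f_n$ is approximately differentiable almost everywhere and maps sets of measure zero to sets of measure zero (Luzin's condition N); (H2) $K\geq 1$ is an integer such that for every $n$ the set $\{y\in[0,1]:\operatorname{card} f_n^{-1}(y)>K\}$ has measure zero; (H3) for every $n$ and every $A\subset\mathbb R$ of measure zero the set $f_n^{-1}(A)$ has measure zero. Let $L$ be the largest $m\in\{1,\dots,N\}$ for which there are $n_1<\dots<n_m$ such that $f_{n_1}([0,1])\cap\dots\cap f_{n_m}([0,1])$ has positive measure, and assume that $$|g_n(x)|<\frac{1}{KL}|f_n'(x)|\quad\text{for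 all }n\in\{1,\dots,N\}\text{ and almost all }x\in[0,1].$$ Then $Ph=\sum_{n=1}^N g_n\cdot(h\circ f_n)$ defines a continuous linear operator $P\colon L^1([0,1])\to L^1([0,1])$, and the following holds. Let $g\in L^1([0,1])$ satisfy $\|P^kg\|>0$ for every integer $k\ge1$, and suppose that there are $m\in\{1,\dots,N\}$ and a real $C<1$ such that $$|g_m(x)|\leq\frac{C}{KL}|f_m'(x)|\quad\text{for almost all }x\in[0,1]$$ and $$\inf_{k\geq1}\frac{1}{\|P^kg\|}\int_{f_m([0,1])}|P^kg(x)|\,dx>0.$$ Then there is $\alpha\in(0,1)$ with $\|P^kg\|\leq\alpha^k\|g\|$ for all $k\geq0$, and the elementary solution of $\varphi=P\varphi+g$ exists, that is, the series $\sum_{k=0}^\infty P^kg$ converges in $L^1([0,1])$. -/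

import Mathlib

open MeasureTheory Set Filter Topology
open scoped unitInterval ENNReal

/-- `x` is a (Lebesgue) density point of `S ⊆ ℝ`. -/
def IsDensityPoint (S : Set ℝ) (x : ℝ) : Prop :=
  Tendsto (fun r : ℝ => volume (S ∩ Metric.closedBall x r) / volume (Metric.closedBall x r))
    (𝓝[>] 0) (𝓝 1)

/-- The linear map `t ↦ l * t` is an approximate differential at `x₀ ∈ E` of `h : E → ℝ`. -/
def HasApproxDerivAt {E : Set ℝ} (h : E → ℝ) (l : ℝ) (x₀ : E) : Prop :=
  ∀ ε : ℝ, 0 < ε →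
    IsDensityPoint
      (Subtype.val '' {x : E | x ≠ x₀ ∧
        |h x - h x₀ - l * ((x : ℝ) - (x₀ : ℝ))| / |(x : ℝ) - (x₀ : ℝ)| < ε})
      (x₀ : ℝ)

/-- `h` is approximately differentiable at `x₀`. -/
def ApproxDifferentiableAt {E : Set ℝ} (h : E → ℝ) (x₀ : E) : Prop :=
  ∃ l : ℝ, HasApproxDerivAt h l x₀

open Classical in
/-- The approximate derivative, with value `0` where `h` is not approximately differentiable. -/
noncomputable def approxDeriv {E : Set ℝ} (h : E → ℝ) (x₀ : E) : ℝ :=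
  if hd : ApproxDifferentiableAt h x₀ then hd.choose else 0

/-- Luzin's condition N for a self-map of `[0,1]`: null sets are mapped to null sets. -/
def LuzinN (f : I → I) : Prop :=
  ∀ A : Set I, volume A = 0 → volume (f '' A) = 0

/-- The largest number `m` of distinct indices `n₁, …, n_m` for which
`f_{n₁}([0,1]) ∩ ⋯ ∩ f_{n_m}([0,1])` has positive measure. -/
noncomputable def overlapNumber {N : ℕ} (f : Fin N → I → I) : ℕ :=
  sSup {m : ℕ | ∃ S : Finset (Fin N), S.Nonempty ∧ S.card = m ∧
    0 < volume (⋂ n ∈ S, range (f n))}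

/-- The real Banach space `L¹([0,1])`. -/
abbrev L1I : Type := Lp ℝ 1 (volume : Measure I)

/-- `φ₀` is the elementary solution of `φ = P φ + u`, that is, the series `∑ Pᵏ u` converges
to `φ₀` in `L¹([0,1])`. -/
def IsElementarySolution (P : L1I →L[ℝ] L1I) (u φ₀ : L1I) : Prop :=
  Tendsto (fun M : ℕ => ∑ k ∈ Finset.range M, (P ^ k) u) atTop (𝓝 φ₀)

/-!
Since `f n` has an approximate derivative almost everywhere, and this derivative does not vanish,
`f n` agrees with a Lipschitz function on each of countably many sets that cover almost all of
`[0,1]`; cutting these sets further makes `f n` differentiable and injective on each of them. The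
change of variables formula on the pieces, of which at most `K` have a given point in their image,
yields `∫ |f n'| * (w ∘ f n) ≤ K * ∫_{range (f n)} w` for `w ≥ 0`; condition N makes the image of
the null set left over irrelevant.

Almost every point lies in at most `L` of the ranges, so summing over `n` gives `‖P h‖ ≤ ‖h‖`, with
strict inequality when `P h ≠ 0` because the bounds on the weights are strict. The spare factor `C`
on `f m` makes `P` lose, in addition, a fixed proportion of the mass that `h` has on `range (f m)`.
By the assumption on the infimum this mass is comparable to `‖h‖` for `h = P ^ k u` with `k ≥ 1`,
so the ratios `‖P ^ (k + 1) u‖ / ‖P ^ k u‖` stay below a constant less than `1` for `k ≥ 1`; for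
`k = 0` the strict inequality suffices.
-/

open scoped NNReal

theorem nonempty_inter_of_measure_lt_add₀ {α : Type*} [MeasurableSpace α] {μ : Measure α}
    {s t u : Set α} (ht : NullMeasurableSet t μ) (hs : s ⊆ u) (htu : t ⊆ u)
    (h : μ u < μ s + μ t) : (s ∩ t).Nonempty := by
  obtain ⟨t', ht't, ht', htt'⟩ := ht.exists_measurable_subset_ae_eq
  rw [← measure_congr htt'] at h
  exact (nonempty_inter_of_measure_lt_add μ ht' hs (ht't.trans htu) h).mono
    (inter_subset_inter_right _ ht't)

theorem nullMeasurableSet_sep_of_restrict {α : Type*} [MeasurableSpace α] {μ : Measure α}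
    {A : Set α} {p : α → Prop} (hA : NullMeasurableSet A μ)
    (hp : NullMeasurableSet {x | p x} (μ.restrict A)) : NullMeasurableSet {x ∈ A | p x} μ := by
  have h := (nullMeasurableSet_restrict hA).1 hp
  rwa [inter_comm] at h

namespace IsDensityPoint

theorem eventually_mul_volume_lt {S : Set ℝ} {x : ℝ} (h : IsDensityPoint S x) {c : ℝ≥0∞}
    (hc : c < 1) :
    ∀ᶠ r : ℝ in 𝓝[>] 0,
      c * volume (Metric.closedBall x r) < volume (S ∩ Metric.closedBall x r) := by
  filter_upwards [h.eventually (lt_mem_nhds hc), self_mem_nhdsWithin] with r hr (hr0 : 0 < r)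
  rwa [ENNReal.lt_div_iff_mul_lt] at hr
  · exact .inl (by simp [Real.volume_closedBall, hr0])
  · exact .inl (by simp [Real.volume_closedBall, ENNReal.mul_eq_top])

theorem mem_closure_inter {S T : Set ℝ} {x : ℝ} (hS : IsDensityPoint S x)
    (hT : IsDensityPoint T x) (hTm : MeasurableSet T) : x ∈ closure (S ∩ T) := by
  refine Metric.mem_closure_iff.2 fun ε hε => ?_
  have hsmall : ∀ᶠ r : ℝ in 𝓝[>] 0, r < ε := mem_nhdsWithin_of_mem_nhds (Iio_mem_nhds hε)
  obtain ⟨r, hSr, hTr, hrε⟩ := ((hS.eventually_mul_volume_lt ENNReal.one_half_lt_one).and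
    ((hT.eventually_mul_volume_lt ENNReal.one_half_lt_one).and hsmall)).exists
  obtain ⟨y, ⟨hyS, hyr⟩, hyT, -⟩ := nonempty_inter_of_measure_lt_add volume
    (hTm.inter Metric.isClosed_closedBall.measurableSet) (u := Metric.closedBall x r)
    inter_subset_right inter_subset_right (by
      convert ENNReal.add_lt_add hSr hTr using 1
      rw [← add_mul, ENNReal.inv_two_add_inv_two, one_mul])
  exact ⟨y, ⟨hyS, hyT⟩, (Metric.mem_closedBall'.1 hyr).trans_lt hrε⟩

end IsDensityPoint

theorem ae_isDensityPoint (S : Set ℝ) : ∀ᵐ x ∂volume.restrict S, IsDensityPoint S x :=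
  Besicovitch.ae_tendsto_measure_inter_div volume S

/-- `HasApproxDerivAt` for a real function near the set `A`: its values off `A` are ignored, and
`A` itself must have `x` as a density point. -/
def HasApproxDerivWithinAt (φ : ℝ → ℝ) (l : ℝ) (A : Set ℝ) (x : ℝ) : Prop :=
  ∀ ε : ℝ, 0 < ε →
    IsDensityPoint {y | y ∈ A ∧ y ≠ x ∧ |φ y - φ x - l * (y - x)| / |y - x| < ε} x

/-- The points `x` such that, for every `r < 1 / (n + 1)`, more than three quarters of the ball
`[x - r, x + r]` consists of points of `A` to which `φ` has slope at most `n + 1` from `x`. Three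
quarters is what makes the large parts of two balls of radius `r` at distance `r` meet: their
union has measure `3 * r = 3 / 4 * (2 * r + 2 * r)`. -/
def slopeSet (φ : ℝ → ℝ) (A : Set ℝ) (n : ℕ) : Set ℝ :=
  {x | ∀ r : ℝ, 0 < r → r < 1 / ((n : ℝ) + 1) →
    3 / 4 * volume (Metric.closedBall x r) <
      volume ({y ∈ A | |φ y - φ x| ≤ (n + 1) * |y - x|} ∩ Metric.closedBall x r)}

namespace HasApproxDerivWithinAt

variable {φ F : ℝ → ℝ} {l d x : ℝ} {A T : Set ℝ}

theorem eq_of_hasDerivAt (hφ : HasApproxDerivWithinAt φ l A x) (hF : HasDerivAt F d x)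
    (hT : IsDensityPoint T x) (hTm : MeasurableSet T) (hφF : EqOn φ F T) (hx : x ∈ T) :
    l = d := by
  refine eq_of_forall_dist_le fun ε hε => ?_
  have hφT := mem_closure_iff_frequently.1
    ((hφ (ε / 2) (half_pos hε)).mem_closure_inter hT hTm)
  obtain ⟨y, ⟨⟨-, hyx, hφy⟩, hyT⟩, hFy⟩ :=
    (hφT.and_eventually ((hasDerivAt_iff_isLittleO.1 hF).bound (half_pos hε))).exists
  have hpos : 0 < |y - x| := abs_pos.2 (sub_ne_zero.2 hyx)
  rw [div_lt_iff₀ hpos, hφF hyT, hφF hx] at hφy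
  rw [smul_eq_mul, mul_comm _ d] at hFy
  simp only [Real.norm_eq_abs] at hFy
  refine le_of_mul_le_mul_right ?_ hpos
  calc |l - d| * |y - x| = |(F y - F x - d * (y - x)) - (F y - F x - l * (y - x))| := by
        rw [← abs_mul]; congr 1; ring
    _ ≤ |F y - F x - d * (y - x)| + |F y - F x - l * (y - x)| := abs_sub _ _
    _ ≤ ε * |y - x| := by linarith

theorem exists_mem_slopeSet (h : HasApproxDerivWithinAt φ l A x) : ∃ n, x ∈ slopeSet φ A n := by
  have hc : (3 / 4 : ℝ≥0∞) < 1 := ENNReal.div_lt_of_lt_mul (by norm_num)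
  obtain ⟨δ, hδ : 0 < δ, hball⟩ :=
    mem_nhdsGT_iff_exists_Ioo_subset.1 ((h 1 one_pos).eventually_mul_volume_lt hc)
  obtain ⟨n₁, hn₁⟩ := exists_nat_one_div_lt hδ
  obtain ⟨n₂, hn₂⟩ := exists_nat_ge |l|
  refine ⟨max n₁ n₂, fun r hr0 hr => (hball ⟨hr0, ?_⟩).trans_le (measure_mono ?_)⟩
  · exact hr.trans ((Nat.one_div_le_one_div (le_max_left n₁ n₂)).trans_lt hn₁)
  rintro y ⟨⟨hyA, hyx, hy⟩, hyr⟩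
  refine ⟨⟨hyA, ?_⟩, hyr⟩
  rw [div_lt_one (abs_pos.2 (sub_ne_zero.2 hyx))] at hy
  calc |φ y - φ x| = |(φ y - φ x - l * (y - x)) + l * (y - x)| := by rw [sub_add_cancel]
    _ ≤ |φ y - φ x - l * (y - x)| + |l| * |y - x| := (abs_add_le _ _).trans_eq (by rw [abs_mul])
    _ ≤ |y - x| + max n₁ n₂ * |y - x| := by
        gcongr
        exact hn₂.trans (by exact_mod_cast le_max_right _ _)
    _ = ((max n₁ n₂ : ℕ) + 1) * |y - x| := by push_cast; ring

end HasApproxDerivWithinAt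

section SlopeSet

variable {φ : ℝ → ℝ} {A : Set ℝ}

theorem abs_sub_le_of_mem_slopeSet (hA : MeasurableSet A)
    (hφ : AEMeasurable φ (volume.restrict A)) {n : ℕ} {x x' : ℝ} (hx : x ∈ slopeSet φ A n)
    (hx' : x' ∈ slopeSet φ A n) (hlt : x < x') (hd : x' - x < 1 / ((n : ℝ) + 1)) :
    |φ x - φ x'| ≤ 2 * (n + 1) * |x - x'| := by
  set r := x' - x
  have hr0 : 0 < r := sub_pos.2 hlt
  have hnull : NullMeasurableSet {y ∈ A | |φ y - φ x'| ≤ (n + 1) * |y - x'|} volume :=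
    nullMeasurableSet_sep_of_restrict hA.nullMeasurableSet
      (nullMeasurableSet_le (hφ.sub_const _).abs (by fun_prop))
  obtain ⟨y, ⟨⟨-, hy⟩, hyr⟩, ⟨-, hy'⟩, hyr'⟩ := nonempty_inter_of_measure_lt_add₀
    (hnull.inter Metric.isClosed_closedBall.measurableSet.nullMeasurableSet)
    (u := Icc (x - r) (x' + r))
    (inter_subset_right.trans
      (Real.closedBall_eq_Icc.trans_subset (Icc_subset_Icc le_rfl (by linarith))))
    (inter_subset_right.trans
      (Real.closedBall_eq_Icc.trans_subset (Icc_subset_Icc (by linarith) le_rfl)))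
    (by
      refine lt_of_eq_of_lt ?_ (ENNReal.add_lt_add (hx r hr0 hd) (hx' r hr0 hd))
      have h34 : (3 / 4 : ℝ≥0∞) = ENNReal.ofReal (3 / 4) := by
        rw [ENNReal.ofReal_div_of_pos (by norm_num)]; norm_num
      rw [Real.volume_closedBall, Real.volume_closedBall, Real.volume_Icc, h34,
        ← ENNReal.ofReal_mul (by norm_num), ← ENNReal.ofReal_add (by positivity) (by positivity)]
      congr 1
      linarith)
  rw [Metric.mem_closedBall, Real.dist_eq] at hyr hyr'
  calc |φ x - φ x'| = |(φ y - φ x') - (φ y - φ x)| := by rw [sub_sub_sub_cancel_left]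
    _ ≤ |φ y - φ x'| + |φ y - φ x| := abs_sub _ _
    _ ≤ (n + 1) * r + (n + 1) * r := by
        gcongr
        · exact hy'.trans (by gcongr)
        · exact hy.trans (by gcongr)
    _ = 2 * (n + 1) * |x - x'| := by rw [abs_sub_comm, abs_of_pos hr0]; ring

theorem lipschitzOnWith_slopeSet (hA : MeasurableSet A)
    (hφ : AEMeasurable φ (volume.restrict A)) (n : ℕ) (p : ℤ) :
    LipschitzOnWith (2 * (n + 1)) φ (slopeSet φ A n ∩ {x | ⌊x * (n + 1)⌋ = p}) := by
  refine LipschitzOnWith.of_dist_le_mul fun x hx x' hx' => ?_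
  wlog hlt : x < x' generalizing x x'
  · rcases (not_lt.1 hlt).eq_or_lt with rfl | hlt
    · simp
    · rw [dist_comm, dist_comm x]
      exact this x' hx' x hx hlt
  refine (abs_sub_le_of_mem_slopeSet hA hφ hx.1 hx'.1 hlt ?_).trans_eq (by simp [Real.dist_eq])
  have hfloor := Int.abs_sub_lt_one_of_floor_eq_floor (hx'.2.trans hx.2.symm)
  rw [lt_div_iff₀ (by positivity), sub_mul]
  exact (le_abs_self _).trans_lt hfloor

theorem exists_countable_lipschitz_cover (hA : MeasurableSet A)
    (hφ : AEMeasurable φ (volume.restrict A)) :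
    ∃ F : ℕ × ℤ → ℝ → ℝ, (∀ i, ∃ C, LipschitzWith C (F i)) ∧
      ∀ x l, HasApproxDerivWithinAt φ l A x → ∃ i, φ x = F i x := by
  choose F hF hφF using fun i : ℕ × ℤ => (lipschitzOnWith_slopeSet hA hφ i.1 i.2).extend_real
  refine ⟨F, fun i => ⟨_, hF i⟩, fun x l h => ?_⟩
  obtain ⟨n, hn⟩ := h.exists_mem_slopeSet
  exact ⟨(n, ⌊x * (n + 1)⌋), hφF _ ⟨hn, rfl⟩⟩

end SlopeSet

theorem exists_measurableSet_hasDerivWithinAt_of_lipschitz {φ φ' F : ℝ → ℝ} {A : Set ℝ} {C : ℝ≥0}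
    (hA : MeasurableSet A) (hφ : AEMeasurable φ (volume.restrict A)) (hF : LipschitzWith C F)
    (h : ∀ᵐ x ∂volume.restrict A, HasApproxDerivWithinAt φ (φ' x) A x) :
    ∃ V ⊆ A, MeasurableSet V ∧ volume ({x ∈ A | φ x = F x} \ V) = 0 ∧
      ∀ x ∈ V, HasDerivWithinAt φ (φ' x) V x := by
  obtain ⟨S, hSs, hSm, hSae⟩ := (nullMeasurableSet_sep_of_restrict hA.nullMeasurableSet
    (nullMeasurableSet_eq_fun hφ hF.continuous.aemeasurable)).exists_measurable_subset_ae_eq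
  have hSA : S ⊆ A := fun x hx => (hSs hx).1
  have hφF : EqOn φ F S := fun x hx => (hSs hx).2
  have hderiv : ∀ᵐ x ∂volume.restrict S, HasDerivAt F (φ' x) x := by
    filter_upwards [ae_restrict_of_ae_restrict_of_subset hSA h, ae_isDensityPoint S,
      ae_restrict_of_ae hF.ae_differentiableAt_real, ae_restrict_mem hSm] with x hx hxS hxF hxmem
    rw [hx.eq_of_hasDerivAt hxF.hasDerivAt hxS hSm hφF hxmem]
    exact hxF.hasDerivAt
  obtain ⟨G, hG, hGm, hGF⟩ := hderiv.exists_measurable_mem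
  refine ⟨S ∩ G, inter_subset_left.trans hSA, hSm.inter hGm, ?_, fun x hx => ?_⟩
  · rw [sdiff_inter]
    refine measure_union_null (ae_le_set.1 hSae.symm.le)
      (ae_le_set.1 (hSae.symm.le.trans ?_))
    exact (ae_restrict_iff' hSm).1 hG
  · exact (hGF x hx.2).hasDerivWithinAt.congr (fun y hy => hφF hy.1) (hφF hx.1)

theorem exists_pos_approximatesLinearOn_injOn {E F : Type*} [NormedAddCommGroup E]
    [NormedSpace ℝ E] [NormedAddCommGroup F] [NormedSpace ℝ F] (A : E →L[ℝ] F) :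
    ∃ r : ℝ≥0, r ≠ 0 ∧ (A.IsInvertible → ∀ (f : E → F) (s : Set E),
      ApproximatesLinearOn f A s r → InjOn f s) := by
  by_cases hA : A.IsInvertible
  · obtain ⟨e, rfl⟩ := hA
    rcases e.subsingleton_or_nnnorm_symm_pos with hE | he
    · exact ⟨1, one_ne_zero, fun _ _ _ h => h.injOn (.inl hE)⟩
    · have hr := inv_pos.2 he
      exact ⟨_, (half_pos hr).ne', fun _ _ _ h => h.injOn (.inr (half_lt_self hr))⟩
  · exact ⟨1, one_ne_zero, fun h => absurd h hA⟩

theorem exists_partition_injOn_of_hasFDerivWithinAt {E F : Type*} [NormedAddCommGroup E]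
    [NormedSpace ℝ E] [FiniteDimensional ℝ E] [MeasurableSpace E] [BorelSpace E]
    [NormedAddCommGroup F] [NormedSpace ℝ F] [SecondCountableTopology F]
    {f : E → F} {f' : E → E →L[ℝ] F} {s : Set E}
    (hf : ∀ x ∈ s, HasFDerivWithinAt f (f' x) s x) (hf' : ∀ x ∈ s, (f' x).IsInvertible) :
    ∃ t : ℕ → Set E, (∀ n, MeasurableSet (t n)) ∧ s ⊆ ⋃ n, t n ∧ ∀ n, InjOn f (s ∩ t n) := by
  choose r hr hinj using exists_pos_approximatesLinearOn_injOn (E := E) (F := F)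
  obtain ⟨t, A, -, htm, hst, happrox, hA⟩ :=
    exists_partition_approximatesLinearOn_of_hasFDerivWithinAt f s f' hf r hr
  refine ⟨t, htm, hst, fun n => ?_⟩
  rcases s.eq_empty_or_nonempty with rfl | hs
  · simp
  obtain ⟨x, hx, hAx⟩ := hA hs n
  exact hinj _ (hAx ▸ hf' x hx) _ _ (happrox n)

theorem isInvertible_toSpanSingleton {𝕜 : Type*} [NontriviallyNormedField 𝕜] {c : 𝕜}
    (hc : c ≠ 0) : (ContinuousLinearMap.toSpanSingleton 𝕜 c).IsInvertible :=
  ⟨ContinuousLinearEquiv.unitsEquivAut 𝕜 (Units.mk0 c hc), by ext; simp⟩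

section Pieces

variable {φ φ' : ℝ → ℝ} {A : Set ℝ}

theorem exists_cover_injOn_hasDerivWithinAt
    (hA : MeasurableSet A) (hφ : AEMeasurable φ (volume.restrict A))
    (h : ∀ᵐ x ∂volume.restrict A, HasApproxDerivWithinAt φ (φ' x) A x)
    (hne : ∀ᵐ x ∂volume.restrict A, φ' x ≠ 0) :
    ∃ U : ℕ → Set ℝ, (∀ i, U i ⊆ A) ∧ (∀ i, MeasurableSet (U i)) ∧ volume (A \ ⋃ i, U i) = 0 ∧
      (∀ i, ∀ x ∈ U i, HasDerivWithinAt φ (φ' x) (U i) x) ∧ ∀ i, InjOn φ (U i) := by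
  obtain ⟨F, hF, hcover⟩ := exists_countable_lipschitz_cover hA hφ
  choose C hF using hF
  choose V hVA hVm hV0 hVd using fun i =>
    exists_measurableSet_hasDerivWithinAt_of_lipschitz hA hφ (hF i) h
  obtain ⟨G, hG, hGm, hGφ⟩ := (h.and hne).exists_measurable_mem
  have hVGd : ∀ i, ∀ x ∈ V i ∩ G, HasDerivWithinAt φ (φ' x) (V i ∩ G) x :=
    fun i x hx => (hVd i x hx.1).mono inter_subset_left
  choose t htm hVt hinj using fun i => exists_partition_injOn_of_hasFDerivWithinAt
    (fun x hx => (hVGd i x hx).hasFDerivWithinAt)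
    (fun x hx => isInvertible_toSpanSingleton (hGφ x hx.2).2)
  obtain ⟨e, he⟩ := exists_surjective_nat ((ℕ × ℤ) × ℕ)
  refine ⟨fun k => V (e k).1 ∩ G ∩ t (e k).1 (e k).2, fun k x hx => hVA _ hx.1.1,
    fun k => ((hVm _).inter hGm).inter (htm _ _), ?_,
    fun k x hx => (hVGd _ x hx.1).mono inter_subset_left, fun k => hinj _ _⟩
  refine measure_mono_null (t := A \ G ∪ ⋃ i, ({x ∈ A | φ x = F i x} \ V i)) ?_
    (measure_union_null (ae_le_set.1 ((ae_restrict_iff' hA).1 hG)) (measure_iUnion_null hV0))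
  rintro x ⟨hxA, hxU⟩
  by_cases hxG : x ∈ G
  · obtain ⟨i, hi⟩ := hcover x _ (hGφ x hxG).1
    refine .inr (mem_iUnion.2 ⟨i, ⟨hxA, hi⟩, fun hxV => hxU ?_⟩)
    obtain ⟨n, hn⟩ := mem_iUnion.1 (hVt i ⟨hxV, hxG⟩)
    obtain ⟨k, hk⟩ := he (i, n)
    exact mem_iUnion.2 ⟨k, by simpa only [hk] using ⟨⟨hxV, hxG⟩, hn⟩⟩
  · exact .inl ⟨hxA, hxG⟩

theorem exists_disjoint_injOn_hasDerivWithinAt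
    (hA : MeasurableSet A) (hφ : AEMeasurable φ (volume.restrict A))
    (h : ∀ᵐ x ∂volume.restrict A, HasApproxDerivWithinAt φ (φ' x) A x)
    (hne : ∀ᵐ x ∂volume.restrict A, φ' x ≠ 0) :
    ∃ T : ℕ → Set ℝ, Pairwise (Function.onFun Disjoint T) ∧ (∀ i, T i ⊆ A) ∧
      (∀ i, MeasurableSet (T i)) ∧ volume (A \ ⋃ i, T i) = 0 ∧
      (∀ i, ∀ x ∈ T i, HasDerivWithinAt φ (φ' x) (T i) x) ∧ ∀ i, InjOn φ (T i) := by
  obtain ⟨U, hUA, hUm, hU0, hUd, hUinj⟩ := exists_cover_injOn_hasDerivWithinAt hA hφ h hne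
  have hTU : ∀ i, disjointed U i ⊆ U i := disjointed_subset U
  refine ⟨disjointed U, disjoint_disjointed U, fun i => (hTU i).trans (hUA i),
    fun i => .disjointed hUm i, ?_, fun i x hx => (hUd i x (hTU i hx)).mono (hTU i),
    fun i => (hUinj i).mono (hTU i)⟩
  rwa [iUnion_disjointed]

end Pieces

theorem tsum_setLIntegral_le {ι Y : Type*} [Countable ι] [MeasurableSpace Y] {ν : Measure Y}
    {A : ι → Set Y} {w : Y → ℝ≥0∞} {k : ℕ} (hA : ∀ i, NullMeasurableSet (A i) ν)
    (hw : AEMeasurable w ν) (hk : ∀ᵐ y ∂ν, {i | y ∈ A i}.encard ≤ k) :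
    ∑' i, ∫⁻ y in A i, w y ∂ν ≤ k * ∫⁻ y, w y ∂ν := by
  calc ∑' i, ∫⁻ y in A i, w y ∂ν = ∫⁻ y, ∑' i, (A i).indicator w y ∂ν := by
        rw [lintegral_tsum fun i => hw.indicator₀ (hA i)]
        simp only [lintegral_indicator₀ (hA _)]
    _ ≤ ∫⁻ y, k * w y ∂ν := by
        refine lintegral_mono_ae (hk.mono fun y hy => ?_)
        calc ∑' i, (A i).indicator w y = ∑' i, {i | y ∈ A i}.indicator (fun _ => w y) i := rfl
          _ = ({i | y ∈ A i}.encard : ℝ≥0∞) * w y := by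
              rw [← tsum_subtype, ENNReal.tsum_set_const]
          _ ≤ k * w y := by
              gcongr
              exact_mod_cast hy
    _ = k * ∫⁻ y, w y ∂ν := lintegral_const_mul' _ _ (ENNReal.natCast_ne_top k)

section Jacobian

variable {X Y : Type*} [MeasurableSpace X] [MeasurableSpace Y]

/-- `J` is the (absolute) Jacobian of `h` on `S`, where `h` is injective: `J` and `h` satisfy the
change of variables formula. -/
structure HasJacobianOn (h : X → Y) (J : X → ℝ≥0) (S : Set X) (μ : Measure X) (ν : Measure Y) :
    Prop where
  measurableSet : MeasurableSet S
  injOn : InjOn h S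
  measurableSet_image : MeasurableSet (h '' S)
  aemeasurable : AEMeasurable J (μ.restrict S)
  lintegral_mul_comp : ∀ w : Y → ℝ≥0∞,
    ∫⁻ x in S, J x * w (h x) ∂μ = ∫⁻ y in h '' S, w y ∂ν

/-- `J` is the Jacobian of `h` on each of countably many disjoint injectivity domains that cover
almost all of the space. -/
def HasPiecewiseJacobian (h : X → Y) (J : X → ℝ≥0) (μ : Measure X) (ν : Measure Y) : Prop :=
  ∃ T : ℕ → Set X, (∀ i, HasJacobianOn h J (T i) μ ν) ∧
    Pairwise (Function.onFun Disjoint T) ∧ ∀ᵐ x ∂μ, x ∈ ⋃ i, T i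

namespace HasPiecewiseJacobian

variable {h : X → Y} {J : X → ℝ≥0} {μ : Measure X} {ν : Measure Y}

theorem aemeasurable (hJ : HasPiecewiseJacobian h J μ ν) : AEMeasurable J μ := by
  obtain ⟨T, hT, -, hcover⟩ := hJ
  rw [← Measure.restrict_eq_self_of_ae_mem hcover, aemeasurable_iUnion_iff]
  exact fun i => (hT i).aemeasurable

theorem nullMeasurableSet_range (hJ : HasPiecewiseJacobian h J μ ν)
    (hh : ∀ Z : Set X, μ Z = 0 → ν (h '' Z) = 0) : NullMeasurableSet (range h) ν := by
  obtain ⟨T, hT, -, hcover⟩ := hJ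
  have himage : MeasurableSet (h '' ⋃ i, T i) := by
    rw [image_iUnion]
    exact .iUnion fun i => (hT i).measurableSet_image
  rw [← image_univ, ← union_compl_self (⋃ i, T i), image_union]
  exact himage.nullMeasurableSet.union (.of_null (hh _ hcover))

theorem lintegral_mul_comp_le (hJ : HasPiecewiseJacobian h J μ ν) {K : ℕ}
    (hK : ∀ᵐ y ∂ν, (h ⁻¹' {y}).encard ≤ K) {w : Y → ℝ≥0∞} (hw : AEMeasurable w ν) :
    ∫⁻ x, J x * w (h x) ∂μ ≤ K * ∫⁻ y in range h, w y ∂ν := by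
  obtain ⟨T, hT, hdisj, hcover⟩ := hJ
  have himage : ∀ i, ν.restrict (h '' T i) = (ν.restrict (range h)).restrict (h '' T i) := by
    intro i
    rw [Measure.restrict_restrict (hT i).measurableSet_image,
      inter_eq_self_of_subset_left (image_subset_range _ _)]
  calc ∫⁻ x, J x * w (h x) ∂μ = ∫⁻ x in ⋃ i, T i, J x * w (h x) ∂μ := by
        rw [Measure.restrict_eq_self_of_ae_mem hcover]
    _ = ∑' i, ∫⁻ x in T i, J x * w (h x) ∂μ :=
        lintegral_iUnion (fun i => (hT i).measurableSet) hdisj _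
    _ = ∑' i, ∫⁻ y in h '' T i, w y ∂ν.restrict (range h) := by
        simp only [(hT _).lintegral_mul_comp, himage]
    _ ≤ K * ∫⁻ y in range h, w y ∂ν := by
        refine tsum_setLIntegral_le (fun i => (hT i).measurableSet_image.nullMeasurableSet)
          hw.restrict (ae_restrict_of_ae (hK.mono fun y hy => ?_))
        choose x hxT hxy using fun i : {i | y ∈ h '' T i} => i.2
        refine (Function.Embedding.encard_le ⟨fun i => ⟨x i, hxy i⟩, fun i j hij => ?_⟩).trans hy
        have hxij : x i = x j := congrArg Subtype.val hij
        by_contra hne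
        exact disjoint_left.1 (hdisj (Subtype.coe_ne_coe.2 hne)) (hxT i) (hxij ▸ hxT j)

end HasPiecewiseJacobian

theorem map_restrict_comap_preimage {i : X → Y} (hi : MeasurableEmbedding i) (μ : Measure Y)
    {S : Set Y} (hSm : MeasurableSet S) (hS : S ⊆ range i) :
    ((μ.comap i).restrict (i ⁻¹' S)).map i = μ.restrict S := by
  rw [← hi.restrict_map, hi.map_comap, Measure.restrict_restrict hSm,
    inter_eq_self_of_subset_left hS]

theorem HasJacobianOn.comap {X₀ Y₀ : Type*} [MeasurableSpace X₀] [MeasurableSpace Y₀]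
    {i : X₀ → X} {j : Y₀ → Y} {h : X → Y} {f : X₀ → Y₀} {J : X → ℝ≥0} {S : Set X} {μ : Measure X}
    {ν : Measure Y} (hJ : HasJacobianOn h J S μ ν) (hi : MeasurableEmbedding i)
    (hj : MeasurableEmbedding j) (hS : S ⊆ range i) (hf : ∀ x, j (f x) = h (i x)) :
    HasJacobianOn f (J ∘ i) (i ⁻¹' S) (μ.comap i) (ν.comap j) := by
  have himage : f '' (i ⁻¹' S) = j ⁻¹' (h '' S) := by
    ext y
    constructor
    · rintro ⟨x, hx, rfl⟩
      exact ⟨i x, hx, (hf x).symm⟩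
    · rintro ⟨s, hs, hsy⟩
      obtain ⟨x, rfl⟩ := hS hs
      exact ⟨x, hs, hj.injective ((hf x).trans hsy)⟩
  have hrange : h '' S ⊆ range j := by
    rintro _ ⟨s, hs, rfl⟩
    obtain ⟨x, rfl⟩ := hS hs
    exact ⟨f x, hf x⟩
  have hμ := map_restrict_comap_preimage hi μ hJ.measurableSet hS
  have hν := map_restrict_comap_preimage hj ν hJ.measurableSet_image hrange
  refine ⟨hi.measurable hJ.measurableSet, fun x hx y hy hxy => ?_,
    himage ▸ hj.measurable hJ.measurableSet_image, ?_, fun w => ?_⟩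
  · exact hi.injective (hJ.injOn hx hy (by rw [← hf, ← hf, hxy]))
  · rw [← hi.aemeasurable_map_iff, hμ]
    exact hJ.aemeasurable
  · calc ∫⁻ x in i ⁻¹' S, (J ∘ i) x * w (f x) ∂μ.comap i
        = ∫⁻ x in S, J x * Function.extend j w 0 (h x) ∂μ := by
          simp only [← hμ, hi.lintegral_map, ← hf, hj.injective.extend_apply, Function.comp_apply]
      _ = ∫⁻ y in h '' S, Function.extend j w 0 y ∂ν := hJ.lintegral_mul_comp _
      _ = ∫⁻ y in f '' (i ⁻¹' S), w y ∂ν.comap j := by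
          simp only [← hν, hj.lintegral_map, hj.injective.extend_apply, himage]

end Jacobian

theorem hasJacobianOn_of_hasDerivWithinAt {φ φ' : ℝ → ℝ} {S : Set ℝ} (hS : MeasurableSet S)
    (h : ∀ x ∈ S, HasDerivWithinAt φ (φ' x) S x) (hinj : InjOn φ S) :
    HasJacobianOn φ (fun x => ‖φ' x‖₊) S volume volume where
  measurableSet := hS
  injOn := hinj
  measurableSet_image :=
    measurable_image_of_fderivWithin hS (fun x hx => (h x hx).hasFDerivWithinAt) hinj
  aemeasurable := by
    have hφ' := aemeasurable_fderivWithin volume hS (fun x hx => (h x hx).hasFDerivWithinAt)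
    simpa using (hφ'.apply_continuousLinearMap 1).nnnorm
  lintegral_mul_comp w := by
    rw [lintegral_image_eq_lintegral_abs_deriv_mul hS h hinj]
    simp only [← enorm_eq_nnnorm, Real.enorm_eq_ofReal_abs]

theorem ApproxDifferentiableAt.hasApproxDerivAt {E : Set ℝ} {h : E → ℝ} {x : E}
    (hx : ApproxDifferentiableAt h x) : HasApproxDerivAt h (approxDeriv h x) x := by
  rw [approxDeriv, dif_pos hx]
  exact hx.choose_spec

theorem HasApproxDerivAt.hasApproxDerivWithinAt {E : Set ℝ} {h : E → ℝ} {φ : ℝ → ℝ} {l : ℝ} {x : E}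
    (hl : HasApproxDerivAt h l x) (hφ : ∀ y : E, φ y = h y) : HasApproxDerivWithinAt φ l E x := by
  intro ε hε
  convert hl ε hε using 1
  ext y
  constructor
  · rintro ⟨hy, hyx, hlt⟩
    exact ⟨⟨y, hy⟩, ⟨fun heq => hyx (congrArg Subtype.val heq), by rwa [← hφ, ← hφ]⟩, rfl⟩
  · rintro ⟨z, ⟨hzx, hlt⟩, rfl⟩
    exact ⟨z.2, Subtype.coe_ne_coe.2 hzx, by rwa [hφ, hφ]⟩

theorem hasPiecewiseJacobian_approxDeriv {E E' : Set ℝ} (hE : MeasurableSet E)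
    (hE' : MeasurableSet E') {f : E → E'} (hf : AEMeasurable f (volume.comap Subtype.val))
    (hd : ∀ᵐ x ∂volume.comap Subtype.val, ApproxDifferentiableAt (fun y => (f y : ℝ)) x)
    (hne : ∀ᵐ x ∂volume.comap Subtype.val, approxDeriv (fun y => (f y : ℝ)) x ≠ 0) :
    HasPiecewiseJacobian f (fun x => ‖approxDeriv (fun y => (f y : ℝ)) x‖₊)
      (volume.comap Subtype.val) (volume.comap Subtype.val) := by
  set φ : ℝ → ℝ := Function.extend Subtype.val (fun x => (f x : ℝ)) 0
  set φ' : ℝ → ℝ := Function.extend Subtype.val (approxDeriv fun x => (f x : ℝ)) 0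
  have hφ : ∀ x : E, φ x = f x := Subtype.val_injective.extend_apply _ _
  have hφ' : ∀ x : E, φ' x = approxDeriv (fun y => (f y : ℝ)) x :=
    Subtype.val_injective.extend_apply _ _
  have hemb := MeasurableEmbedding.subtype_coe hE
  obtain ⟨T, hTd, hTE, hTm, hT0, hTφ, hTinj⟩ := exists_disjoint_injOn_hasDerivWithinAt
    (φ := φ) (φ' := φ') hE
    (by
      rw [aemeasurable_restrict_iff_comap_subtype hE]
      simpa only [Function.comp_def, hφ] using measurable_subtype_coe.comp_aemeasurable hf)
    (by
      rw [ae_restrict_iff_subtype hE]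
      filter_upwards [hd] with x hx
      exact hφ' x ▸ hx.hasApproxDerivAt.hasApproxDerivWithinAt hφ)
    (by
      rw [ae_restrict_iff_subtype hE]
      simpa only [hφ'] using hne)
  refine ⟨fun i => Subtype.val ⁻¹' T i, fun i => ?_, fun i j hij => (hTd hij).preimage _, ?_⟩
  · have hJ := (hasJacobianOn_of_hasDerivWithinAt (hTm i) (hTφ i) (hTinj i)).comap (f := f) hemb
      (.subtype_coe hE') ((hTE i).trans Subtype.range_coe.superset) fun x => (hφ x).symm
    simpa only [Function.comp_def, hφ'] using hJ
  · rw [← preimage_iUnion]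
    exact (ae_restrict_iff_subtype hE).1 ((ae_restrict_iff' hE).2 (ae_le_set.2 hT0))

section SubJacobian

variable {X Y : Type*} [MeasurableSpace X] [MeasurableSpace Y]

/-- `J` is dominated by the Jacobian of `f`: the change of variables formula holds with `≤`, and
`f` pulls null sets back to null sets. -/
structure IsSubJacobian (f : X → Y) (J : X → ℝ≥0) (μ : Measure X) (ν : Measure Y) : Prop where
  aemeasurable_map : AEMeasurable f μ
  aemeasurable : AEMeasurable J μ
  map_absolutelyContinuous : μ.map f ≪ ν
  nullMeasurableSet_range : NullMeasurableSet (range f) ν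
  lintegral_mul_comp_le : ∀ w : Y → ℝ≥0∞, AEMeasurable w ν →
    ∫⁻ x, J x * w (f x) ∂μ ≤ ∫⁻ y in range f, w y ∂ν

theorem HasPiecewiseJacobian.isSubJacobian {f : X → Y} {J : X → ℝ≥0} {μ : Measure X}
    {ν : Measure Y} {K : ℕ} (hJ : HasPiecewiseJacobian f J μ ν) (hf : AEMeasurable f μ)
    (hfν : μ.map f ≪ ν) (hN : ∀ Z : Set X, μ Z = 0 → ν (f '' Z) = 0)
    (hK : ∀ᵐ y ∂ν, (f ⁻¹' {y}).encard ≤ K) :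
    IsSubJacobian f (fun x => (K : ℝ≥0)⁻¹ * J x) μ ν where
  aemeasurable_map := hf
  aemeasurable := hJ.aemeasurable.const_mul _
  map_absolutelyContinuous := hfν
  nullMeasurableSet_range := hJ.nullMeasurableSet_range hN
  lintegral_mul_comp_le w hw := by
    calc ∫⁻ x, ↑((K : ℝ≥0)⁻¹ * J x) * w (f x) ∂μ
        = ↑(K : ℝ≥0)⁻¹ * ∫⁻ x, J x * w (f x) ∂μ := by
          simp only [ENNReal.coe_mul, mul_assoc]
          exact lintegral_const_mul' _ _ ENNReal.coe_ne_top
      _ ≤ ↑(K : ℝ≥0)⁻¹ * (K * ∫⁻ y in range f, w y ∂ν) := by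
          gcongr
          exact hJ.lintegral_mul_comp_le hK hw
      _ ≤ ∫⁻ y in range f, w y ∂ν := by
          rw [← mul_assoc]
          exact mul_le_of_le_one_left' (by exact_mod_cast inv_mul_le_one (a := (K : ℝ≥0)))

namespace IsSubJacobian

variable {f : X → Y} {J : X → ℝ≥0} {μ : Measure X} {ν : Measure Y}

theorem ae_comp (hJ : IsSubJacobian f J μ ν) {p : Y → Prop} (hp : ∀ᵐ y ∂ν, p y) :
    ∀ᵐ x ∂μ, p (f x) :=
  ae_of_ae_map hJ.aemeasurable_map (hJ.map_absolutelyContinuous.ae_le hp)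

variable {𝕜 E : Type*} [NormedField 𝕜] [NormedAddCommGroup E] [NormedSpace 𝕜 E] {h : Y → E}

theorem aestronglyMeasurable_comp (hJ : IsSubJacobian f J μ ν) (hh : AEStronglyMeasurable h ν) :
    AEStronglyMeasurable (fun x => h (f x)) μ :=
  (hh.mono_ac hJ.map_absolutelyContinuous).comp_aemeasurable hJ.aemeasurable_map

theorem lintegral_enorm_smul_comp_le (hJ : IsSubJacobian f J μ ν) {g : X → 𝕜} {c : ℝ≥0}
    (hg : ∀ᵐ x ∂μ, ‖g x‖₊ ≤ c * J x) (hh : AEStronglyMeasurable h ν) :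
    ∫⁻ x, ‖g x • h (f x)‖ₑ ∂μ ≤ c * ∫⁻ y in range f, ‖h y‖ₑ ∂ν := by
  calc ∫⁻ x, ‖g x • h (f x)‖ₑ ∂μ ≤ ∫⁻ x, c * (J x * ‖h (f x)‖ₑ) ∂μ := by
        refine lintegral_mono_ae (hg.mono fun x hx => ?_)
        rw [enorm_smul, ← mul_assoc]
        gcongr
        exact_mod_cast hx
    _ = c * ∫⁻ x, J x * ‖h (f x)‖ₑ ∂μ := lintegral_const_mul' _ _ ENNReal.coe_ne_top
    _ ≤ c * ∫⁻ y in range f, ‖h y‖ₑ ∂ν := by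
        gcongr
        exact hJ.lintegral_mul_comp_le _ hh.enorm

end IsSubJacobian

end SubJacobian

theorem enorm_L1_of_ae_eq {X E : Type*} [MeasurableSpace X] {μ : Measure X} [NormedAddCommGroup E]
    {φ : Lp E 1 μ} {u : X → E} (hφ : φ =ᵐ[μ] u) : ‖φ‖ₑ = ∫⁻ x, ‖u x‖ₑ ∂μ := by
  rw [Lp.enorm_def, eLpNorm_congr_ae hφ, eLpNorm_one_eq_lintegral_enorm]

section ContractiveSystem

variable {ι X Y 𝕜 E : Type*} [MeasurableSpace X] [MeasurableSpace Y]
  [NormedField 𝕜] [NormedAddCommGroup E] [NormedSpace 𝕜 E]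

theorem nnnorm_sum_smul_lt [Fintype ι] {a : ι → 𝕜} {v : ι → E} {c : ι → ℝ≥0}
    (hac : ∀ n, ‖a n‖₊ < c n) (hne : ∑ n, a n • v n ≠ 0) :
    ‖∑ n, a n • v n‖₊ < ∑ n, c n * ‖v n‖₊ := by
  obtain ⟨n, hn, hav⟩ := Finset.exists_ne_zero_of_sum_ne_zero hne
  calc ‖∑ n, a n • v n‖₊ ≤ ∑ n, ‖a n‖₊ * ‖v n‖₊ :=
        (nnnorm_sum_le _ _).trans_eq (by simp only [nnnorm_smul])
    _ < ∑ n, c n * ‖v n‖₊ := by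
        refine Finset.sum_lt_sum (fun n _ => by gcongr; exact (hac n).le) ⟨n, hn, ?_⟩
        have hv : 0 < ‖v n‖₊ := nnnorm_pos.2 (smul_ne_zero_iff.1 hav).2
        gcongr
        exact hac n

/-- The sum `∑ n, g n • (h ∘ f n)`, to which the operator `P` of the theorem sends `h`. -/
def weightedCompSum [Fintype ι] (f : ι → X → Y) (g : ι → X → 𝕜) (h : Y → E) (x : X) : E :=
  ∑ n, g n x • h (f n x)

/-- Maps `f n` whose ranges overlap at most `L` times, with weights `g n` at most `1 / L` times a
sub-Jacobian of `f n`. -/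
structure ContractiveSystem (f : ι → X → Y) (g : ι → X → 𝕜) (J : ι → X → ℝ≥0) (L : ℕ)
    (μ : Measure X) (ν : Measure Y) : Prop where
  isSubJacobian : ∀ n, IsSubJacobian (f n) (J n) μ ν
  aestronglyMeasurable : ∀ n, AEStronglyMeasurable (g n) μ
  nnnorm_le : ∀ n, ∀ᵐ x ∂μ, ‖g n x‖₊ ≤ (L : ℝ≥0)⁻¹ * J n x
  encard_le : ∀ᵐ y ∂ν, {n | y ∈ range (f n)}.encard ≤ L

namespace ContractiveSystem

variable {f : ι → X → Y} {g : ι → X → 𝕜} {J : ι → X → ℝ≥0} {L : ℕ} {μ : Measure X}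
  {ν : Measure Y} {h : Y → E}

theorem aestronglyMeasurable_smul_comp (S : ContractiveSystem f g J L μ ν)
    (hh : AEStronglyMeasurable h ν) (n : ι) :
    AEStronglyMeasurable (fun x => g n x • h (f n x)) μ :=
  (S.aestronglyMeasurable n).smul ((S.isSubJacobian n).aestronglyMeasurable_comp hh)

theorem ae_comp [Finite ι] (S : ContractiveSystem f g J L μ ν) {p : Y → Prop} (hp : ∀ᵐ y ∂ν, p y) :
    ∀ᵐ x ∂μ, ∀ n, p (f n x) :=
  ae_all_iff.2 fun n => (S.isSubJacobian n).ae_comp hp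

variable [Fintype ι]

theorem sum_lintegral_range_le (S : ContractiveSystem f g J L μ ν) {w : Y → ℝ≥0∞}
    (hw : AEMeasurable w ν) :
    ∑ n, ↑(L : ℝ≥0)⁻¹ * ∫⁻ y in range (f n), w y ∂ν ≤ ∫⁻ y, w y ∂ν := by
  calc ∑ n, ↑(L : ℝ≥0)⁻¹ * ∫⁻ y in range (f n), w y ∂ν
      = ↑(L : ℝ≥0)⁻¹ * ∑' n, ∫⁻ y in range (f n), w y ∂ν := by
        rw [← Finset.mul_sum, tsum_fintype]
    _ ≤ ↑(L : ℝ≥0)⁻¹ * (L * ∫⁻ y, w y ∂ν) := by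
        gcongr
        exact tsum_setLIntegral_le (fun n => (S.isSubJacobian n).nullMeasurableSet_range) hw
          S.encard_le
    _ ≤ ∫⁻ y, w y ∂ν := by
        rw [← mul_assoc]
        exact mul_le_of_le_one_left' (by exact_mod_cast inv_mul_le_one (a := (L : ℝ≥0)))

theorem lintegral_enorm_weightedCompSum_le_sum (S : ContractiveSystem f g J L μ ν)
    (hh : AEStronglyMeasurable h ν) :
    ∫⁻ x, ‖weightedCompSum f g h x‖ₑ ∂μ ≤ ∑ n, ∫⁻ x, ‖g n x • h (f n x)‖ₑ ∂μ := by
  rw [← lintegral_finsetSum' _ fun n _ => (S.aestronglyMeasurable_smul_comp hh n).enorm]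
  exact lintegral_mono fun x => enorm_sum_le _ _

theorem lintegral_enorm_weightedCompSum_le (S : ContractiveSystem f g J L μ ν)
    (hh : AEStronglyMeasurable h ν) :
    ∫⁻ x, ‖weightedCompSum f g h x‖ₑ ∂μ ≤ ∫⁻ y, ‖h y‖ₑ ∂ν :=
  (S.lintegral_enorm_weightedCompSum_le_sum hh).trans <| (Finset.sum_le_sum fun n _ =>
    (S.isSubJacobian n).lintegral_enorm_smul_comp_le (S.nnnorm_le n) hh).trans
    (S.sum_lintegral_range_le hh.enorm)

theorem lintegral_enorm_weightedCompSum_add_le (S : ContractiveSystem f g J L μ ν)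
    (hh : AEStronglyMeasurable h ν) {m : ι} {C δ : ℝ≥0} (hC : C + δ ≤ 1)
    (hm : ∀ᵐ x ∂μ, ‖g m x‖₊ ≤ C * (L : ℝ≥0)⁻¹ * J m x) :
    ∫⁻ x, ‖weightedCompSum f g h x‖ₑ ∂μ +
      ↑(δ * (L : ℝ≥0)⁻¹) * ∫⁻ y in range (f m), ‖h y‖ₑ ∂ν ≤ ∫⁻ y, ‖h y‖ₑ ∂ν := by
  classical
  refine (add_le_add_left (S.lintegral_enorm_weightedCompSum_le_sum hh) _).trans
    (le_trans ?_ (S.sum_lintegral_range_le hh.enorm))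
  rw [← Finset.add_sum_erase _ _ (Finset.mem_univ m),
    ← Finset.add_sum_erase _ _ (Finset.mem_univ m), add_right_comm]
  gcongr with n
  · calc ∫⁻ x, ‖g m x • h (f m x)‖ₑ ∂μ + ↑(δ * (L : ℝ≥0)⁻¹) * ∫⁻ y in range (f m), ‖h y‖ₑ ∂ν
        ≤ ↑((C + δ) * (L : ℝ≥0)⁻¹) * ∫⁻ y in range (f m), ‖h y‖ₑ ∂ν := by
          rw [add_mul, ENNReal.coe_add, add_mul]
          gcongr
          exact (S.isSubJacobian m).lintegral_enorm_smul_comp_le hm hh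
      _ ≤ ↑(L : ℝ≥0)⁻¹ * ∫⁻ y in range (f m), ‖h y‖ₑ ∂ν := by
          gcongr
          exact mul_le_of_le_one_left' hC
  · exact (S.isSubJacobian n).lintegral_enorm_smul_comp_le (S.nnnorm_le n) hh

theorem lintegral_enorm_weightedCompSum_lt (S : ContractiveSystem f g J L μ ν)
    (hlt : ∀ n, ∀ᵐ x ∂μ, ‖g n x‖₊ < (L : ℝ≥0)⁻¹ * J n x) (hh : Integrable h ν)
    (hne : ¬ weightedCompSum f g h =ᵐ[μ] 0) :
    ∫⁻ x, ‖weightedCompSum f g h x‖ₑ ∂μ < ∫⁻ y, ‖h y‖ₑ ∂ν := by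
  have hmeas : ∀ n, AEMeasurable (fun x => (J n x : ℝ≥0∞) * ‖h (f n x)‖ₑ) μ := fun n =>
    (S.isSubJacobian n).aemeasurable.coe_nnreal_ennreal.mul
      ((S.isSubJacobian n).aestronglyMeasurable_comp hh.1).enorm
  have hmajorant : ∀ᵐ x ∂μ, weightedCompSum f g h x ≠ 0 → ‖weightedCompSum f g h x‖ₑ <
      ∑ n, ↑(L : ℝ≥0)⁻¹ * (J n x * ‖h (f n x)‖ₑ) := by
    filter_upwards [ae_all_iff.2 hlt] with x hx hne
    have hlt := nnnorm_sum_smul_lt hx hne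
    simp only [mul_assoc] at hlt
    simp only [weightedCompSum, enorm_eq_nnnorm]
    exact_mod_cast hlt
  calc ∫⁻ x, ‖weightedCompSum f g h x‖ₑ ∂μ
      < ∫⁻ x, ∑ n, ↑(L : ℝ≥0)⁻¹ * (J n x * ‖h (f n x)‖ₑ) ∂μ := by
        refine lintegral_strict_mono_of_ae_le_of_frequently_ae_lt
          (Finset.aemeasurable_fun_sum _ fun n _ => (hmeas n).const_mul _)
          ((S.lintegral_enorm_weightedCompSum_le hh.1).trans_lt hh.2).ne ?_
          ((not_eventually.1 hne).and_eventually hmajorant |>.mono fun x hx => (hx.2 hx.1).ne)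
        filter_upwards [hmajorant] with x hx
        by_cases hx0 : weightedCompSum f g h x = 0
        · simp [hx0]
        · exact (hx hx0).le
    _ = ∑ n, ↑(L : ℝ≥0)⁻¹ * ∫⁻ x, J n x * ‖h (f n x)‖ₑ ∂μ := by
        rw [lintegral_finsetSum' _ fun n _ => (hmeas n).const_mul _]
        simp only [lintegral_const_mul' _ _ ENNReal.coe_ne_top]
    _ ≤ ∑ n, ↑(L : ℝ≥0)⁻¹ * ∫⁻ y in range (f n), ‖h y‖ₑ ∂ν := by
        gcongr with n
        exact (S.isSubJacobian n).lintegral_mul_comp_le _ hh.1.enorm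
    _ ≤ ∫⁻ y, ‖h y‖ₑ ∂ν := S.sum_lintegral_range_le hh.1.enorm

theorem integrable_weightedCompSum (S : ContractiveSystem f g J L μ ν) (hh : Integrable h ν) :
    Integrable (weightedCompSum f g h) μ :=
  ⟨Finset.aestronglyMeasurable_fun_sum _ fun n _ => S.aestronglyMeasurable_smul_comp hh.1 n,
    (S.lintegral_enorm_weightedCompSum_le hh.1).trans_lt hh.2⟩

theorem enorm_le_of_ae_eq (S : ContractiveSystem f g J L μ ν) {h : Lp E 1 ν} {k : Lp E 1 μ}
    (hk : k =ᵐ[μ] weightedCompSum f g h) : ‖k‖ₑ ≤ ‖h‖ₑ := by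
  rw [enorm_L1_of_ae_eq hk, enorm_L1_of_ae_eq EventuallyEq.rfl]
  exact S.lintegral_enorm_weightedCompSum_le (Lp.aestronglyMeasurable h)

theorem norm_lt_of_ae_eq (S : ContractiveSystem f g J L μ ν)
    (hlt : ∀ n, ∀ᵐ x ∂μ, ‖g n x‖₊ < (L : ℝ≥0)⁻¹ * J n x) {h : Lp E 1 ν} {k : Lp E 1 μ}
    (hk : k =ᵐ[μ] weightedCompSum f g h) (hk0 : k ≠ 0) : ‖k‖ < ‖h‖ := by
  rw [← toReal_enorm, ← toReal_enorm]
  refine ENNReal.toReal_strict_mono enorm_ne_top ?_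
  rw [enorm_L1_of_ae_eq hk, enorm_L1_of_ae_eq EventuallyEq.rfl]
  exact S.lintegral_enorm_weightedCompSum_lt hlt (L1.integrable_coeFn h) fun h0 =>
    hk0 ((Lp.eq_zero_iff_ae_eq_zero).2 (hk.trans h0))

theorem norm_add_mul_setIntegral_le (S : ContractiveSystem f g J L μ ν) {m : ι} {C δ : ℝ≥0}
    (hC : C + δ ≤ 1) (hm : ∀ᵐ x ∂μ, ‖g m x‖₊ ≤ C * (L : ℝ≥0)⁻¹ * J m x)
    {h : Lp E 1 ν} {k : Lp E 1 μ}
    (hk : k =ᵐ[μ] weightedCompSum f g h) :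
    ‖k‖ + δ * (L : ℝ)⁻¹ * ∫ y in range (f m), ‖h y‖ ∂ν ≤ ‖h‖ := by
  have hle := S.lintegral_enorm_weightedCompSum_add_le (Lp.aestronglyMeasurable h) hC hm
  rw [← enorm_L1_of_ae_eq hk, ← enorm_L1_of_ae_eq (φ := h) EventuallyEq.rfl] at hle
  have hfin := ne_top_of_le_ne_top enorm_ne_top (le_add_self.trans hle)
  have hreal := ENNReal.toReal_mono enorm_ne_top hle
  rw [ENNReal.toReal_add enorm_ne_top hfin, ENNReal.toReal_mul, toReal_enorm, toReal_enorm] at hreal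
  rw [integral_norm_eq_lintegral_enorm (Lp.aestronglyMeasurable h).restrict]
  exact_mod_cast hreal

theorem exists_continuousLinearMap (S : ContractiveSystem f g J L μ ν) :
    ∃ P : Lp E 1 ν →L[𝕜] Lp E 1 μ, ∀ h, P h =ᵐ[μ] weightedCompSum f g h := by
  have hint : ∀ h : Lp E 1 ν, Integrable (weightedCompSum f g h) μ := fun h =>
    S.integrable_weightedCompSum (L1.integrable_coeFn h)
  refine ⟨LinearMap.mkContinuous
    { toFun := fun h => (hint h).toL1 _
      map_add' := fun h₁ h₂ => ?_
      map_smul' := fun c h => ?_ } 1 fun h => ?_, fun h => (hint h).coeFn_toL1⟩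
  · rw [← Integrable.toL1_add, Integrable.toL1_eq_toL1_iff]
    filter_upwards [S.ae_comp (Lp.coeFn_add h₁ h₂)] with x hx
    simp only [weightedCompSum, Pi.add_apply, hx, smul_add, Finset.sum_add_distrib]
  · rw [RingHom.id_apply, ← Integrable.toL1_smul' _ (hint h), Integrable.toL1_eq_toL1_iff]
    filter_upwards [S.ae_comp (Lp.coeFn_smul c h)] with x hx
    simp only [weightedCompSum, Pi.smul_apply, hx, Finset.smul_sum, smul_comm c]
  · rw [one_mul, ← enorm_le_iff_norm_le]
    exact S.enorm_le_of_ae_eq (hint h).coeFn_toL1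

end ContractiveSystem

end ContractiveSystem

section PowerSeries

variable {𝕜 E : Type*} [NormedField 𝕜] [NormedAddCommGroup E] [NormedSpace 𝕜 E] {T : E →L[𝕜] E}
  {u : E}

theorem exists_norm_pow_apply_le_of_norm_lt {θ : ℝ} (hθ : θ < 1) (h0 : 0 < ‖T u‖)
    (h1 : ‖T u‖ < ‖u‖) (hstep : ∀ k, ‖(T ^ (k + 2)) u‖ ≤ θ * ‖(T ^ (k + 1)) u‖) :
    ∃ α : ℝ, 0 < α ∧ α < 1 ∧ ∀ k : ℕ, ‖(T ^ k) u‖ ≤ α ^ k * ‖u‖ := by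
  have hu : 0 < ‖u‖ := h0.trans h1
  set α := max (‖T u‖ / ‖u‖) θ
  have hα0 : 0 < α := lt_max_of_lt_left (div_pos h0 hu)
  refine ⟨α, hα0, max_lt ((div_lt_one hu).2 h1) hθ, fun k => ?_⟩
  induction k with
  | zero => simp
  | succ k ih =>
    have hratio : ‖(T ^ (k + 1)) u‖ ≤ α * ‖(T ^ k) u‖ := by
      cases k with
      | zero => simpa using (div_le_iff₀ hu).1 (le_max_left _ θ)
      | succ k => exact (hstep k).trans (by gcongr; exact le_max_right _ _)
    calc ‖(T ^ (k + 1)) u‖ ≤ α * ‖(T ^ k) u‖ := hratio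
      _ ≤ α * (α ^ k * ‖u‖) := by gcongr
      _ = α ^ (k + 1) * ‖u‖ := by ring

theorem exists_tendsto_sum_pow_apply [CompleteSpace E] {α c : ℝ} (h0 : 0 ≤ α) (h1 : α < 1)
    (hle : ∀ k : ℕ, ‖(T ^ k) u‖ ≤ α ^ k * c) :
    ∃ φ, Tendsto (fun M : ℕ => ∑ k ∈ Finset.range M, (T ^ k) u) atTop (𝓝 φ) :=
  ⟨_, (Summable.of_norm_bounded ((summable_geometric_of_lt_one h0 h1).mul_right c)
    hle).hasSum.tendsto_sum_nat⟩

end PowerSeries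

theorem exists_pos_mul_le_of_iInf_div_pos {ι : Type*} {a b : ι → ℝ} (ha : ∀ i, 0 < a i)
    (hb : ∀ i, 0 ≤ b i) (h : 0 < ⨅ i, 1 / a i * b i) : ∃ δ, 0 < δ ∧ ∀ i, δ * a i ≤ b i := by
  refine ⟨_, h, fun i => (le_div_iff₀ (ha i)).1 ?_⟩
  have hbdd : BddBelow (range fun i => 1 / a i * b i) :=
    ⟨0, forall_mem_range.2 fun i => mul_nonneg (one_div_nonneg.2 (ha i).le) (hb i)⟩
  exact (ciInf_le hbdd i).trans_eq (one_div_mul_eq_div _ _)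

theorem ContractiveSystem.exists_norm_pow_apply_le {ι X 𝕜 E : Type*} [Fintype ι]
    [MeasurableSpace X] [NormedField 𝕜] [NormedAddCommGroup E] [NormedSpace 𝕜 E] {f : ι → X → X}
    {g : ι → X → 𝕜} {J : ι → X → ℝ≥0} {L : ℕ} {μ : Measure X} (S : ContractiveSystem f g J L μ μ)
    (hlt : ∀ n, ∀ᵐ x ∂μ, ‖g n x‖₊ < (L : ℝ≥0)⁻¹ * J n x) {P : Lp E 1 μ →L[𝕜] Lp E 1 μ}
    (hP : ∀ h, P h =ᵐ[μ] weightedCompSum f g h) {u : Lp E 1 μ} (hu : P u ≠ 0) {m : ι} {C : ℝ≥0}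
    (hC : C < 1) (hm : ∀ᵐ x ∂μ, ‖g m x‖₊ ≤ C * (L : ℝ≥0)⁻¹ * J m x) {δ : ℝ} (hδ : 0 < δ)
    (hmass : ∀ k : ℕ, δ * ‖(P ^ (k + 1)) u‖ ≤ ∫ x in range (f m), ‖((P ^ (k + 1)) u) x‖ ∂μ) :
    ∃ α : ℝ, 0 < α ∧ α < 1 ∧ ∀ k : ℕ, ‖(P ^ k) u‖ ≤ α ^ k * ‖u‖ := by
  have hL : 0 < (L : ℝ)⁻¹ := by
    have hμ : μ ≠ 0 := by
      rintro rfl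
      exact hu (Lp.ext (by simp [EventuallyEq]))
    have := ae_neBot.2 hμ
    obtain ⟨x, hx⟩ := (hlt m).exists
    exact_mod_cast left_ne_zero_of_mul hx.ne_bot |> pos_iff_ne_zero.2
  have hspare : 0 < ((1 - C : ℝ≥0) : ℝ) := by exact_mod_cast tsub_pos_of_lt hC
  refine exists_norm_pow_apply_le_of_norm_lt (θ := 1 - (1 - C : ℝ≥0) * (L : ℝ)⁻¹ * δ)
    (by linarith [mul_pos (mul_pos hspare hL) hδ]) (norm_pos_iff.2 hu)
    (S.norm_lt_of_ae_eq hlt (hP u) hu) fun k => ?_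
  have hsave := S.norm_add_mul_setIntegral_le (add_tsub_cancel_of_le hC.le).le hm
    (hP ((P ^ (k + 1)) u))
  rw [← mul_apply_eq_comp, ← pow_succ'] at hsave
  calc ‖(P ^ (k + 2)) u‖
      ≤ ‖(P ^ (k + 1)) u‖ - (1 - C : ℝ≥0) * (L : ℝ)⁻¹ *
          ∫ x in range (f m), ‖((P ^ (k + 1)) u) x‖ ∂μ := le_sub_iff_add_le.2 hsave
    _ ≤ ‖(P ^ (k + 1)) u‖ - (1 - C : ℝ≥0) * (L : ℝ)⁻¹ * (δ * ‖(P ^ (k + 1)) u‖) := by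
        gcongr
        exact hmass k
    _ = (1 - (1 - C : ℝ≥0) * (L : ℝ)⁻¹ * δ) * ‖(P ^ (k + 1)) u‖ := by ring

theorem ae_encard_le_overlapNumber {N : ℕ} (f : Fin N → I → I) :
    ∀ᵐ y : I, {n | y ∈ range (f n)}.encard ≤ overlapNumber f := by
  have hbdd : BddAbove {m : ℕ | ∃ S : Finset (Fin N), S.Nonempty ∧ S.card = m ∧
      0 < volume (⋂ n ∈ S, range (f n))} :=
    ⟨N, by rintro _ ⟨S, -, rfl, -⟩; exact card_finset_fin_le S⟩
  have hnull : ∀ S : Finset (Fin N), overlapNumber f < S.card →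
      ∀ᵐ y : I, y ∉ ⋂ n ∈ S, range (f n) := fun S hS => by
    rw [← measure_eq_zero_iff_ae_notMem, ← nonpos_iff_eq_zero]
    refine not_lt.1 fun hpos => hS.not_ge ?_
    exact le_csSup hbdd ⟨S, Finset.card_pos.1 (Nat.zero_lt_of_lt hS), rfl, hpos⟩
  classical
  filter_upwards [ae_all_iff.2 fun S => eventually_imp_distrib_left.2 (hnull S)] with y hy
  rw [← Set.coe_toFinset {n | y ∈ range (f n)}, Set.encard_coe_eq_coe_finsetCard, Nat.cast_le]
  exact not_lt.1 fun hlt => hy _ hlt (mem_iInter₂.2 fun n hn => by simpa using hn)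

theorem nnnorm_lt_of_abs_lt {K L : ℕ} {a d : ℝ} (h : |a| < 1 / ((K : ℝ) * L) * |d|) :
    ‖a‖₊ < (L : ℝ≥0)⁻¹ * ((K : ℝ≥0)⁻¹ * ‖d‖₊) := by
  rw [← NNReal.coe_lt_coe]
  calc |a| < 1 / ((K : ℝ) * L) * |d| := h
    _ = ↑((L : ℝ≥0)⁻¹ * ((K : ℝ≥0)⁻¹ * ‖d‖₊)) := by
        simp only [NNReal.coe_mul, NNReal.coe_inv, NNReal.coe_natCast, coe_nnnorm,
          Real.norm_eq_abs]
        ring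

theorem nnnorm_le_of_abs_le {K L : ℕ} {a d C : ℝ} (h : |a| ≤ C / ((K : ℝ) * L) * |d|) :
    ‖a‖₊ ≤ C.toNNReal * (L : ℝ≥0)⁻¹ * ((K : ℝ≥0)⁻¹ * ‖d‖₊) := by
  rw [← NNReal.coe_le_coe]
  calc |a| ≤ C / ((K : ℝ) * L) * |d| := h
    _ ≤ C.toNNReal / ((K : ℝ) * L) * |d| := by
        gcongr
        exact Real.le_coe_toNNReal C
    _ = ↑(C.toNNReal * (L : ℝ≥0)⁻¹ * ((K : ℝ≥0)⁻¹ * ‖d‖₊)) := by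
        simp only [NNReal.coe_mul, NNReal.coe_inv, NNReal.coe_natCast, coe_nnnorm,
          Real.norm_eq_abs]
        ring

theorem isSubJacobian_approxDeriv {f : I → I} {K : ℕ} (hf : NullMeasurable f volume)
    (hd : ∀ᵐ x : I, ApproxDifferentiableAt (fun y : I => (f y : ℝ)) x)
    (hne : ∀ᵐ x : I, approxDeriv (fun y : I => (f y : ℝ)) x ≠ 0) (hN : LuzinN f)
    (hK : volume {y : I | (K : ℕ∞) < (f ⁻¹' {y}).encard} = 0)
    (hnull : ∀ A : Set ℝ, volume A = 0 → volume {x : I | (f x : ℝ) ∈ A} = 0) :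
    IsSubJacobian f (fun x => (K : ℝ≥0)⁻¹ * ‖approxDeriv (fun y : I => (f y : ℝ)) x‖₊)
      volume volume := by
  have hfm : AEMeasurable f volume := hf.aemeasurable
  have hmap : Measure.map f volume ≪ volume := by
    refine Measure.AbsolutelyContinuous.mk fun A hA hA0 => ?_
    rw [← volume_image_subtype_coe measurableSet_Icc] at hA0
    rw [Measure.map_apply_of_aemeasurable hfm hA, ← preimage_image_eq A Subtype.val_injective]
    exact hnull _ hA0
  have hcard : ∀ᵐ y : I, (f ⁻¹' {y}).encard ≤ K := by
    simpa only [ae_iff, not_le] using hK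
  exact (hasPiecewiseJacobian_approxDeriv measurableSet_Icc measurableSet_Icc hfm hd
    hne).isSubJacobian hfm hmap hN hcard

theorem contractiveSystem_approxDeriv {N K : ℕ} {f : Fin N → I → I} {g : Fin N → I → ℝ}
    (hf : ∀ n, NullMeasurable (f n) volume) (hg : ∀ n, NullMeasurable (g n) volume)
    (hd : ∀ n, (∀ᵐ x : I, ApproxDifferentiableAt (fun y : I => (f n y : ℝ)) x) ∧ LuzinN (f n))
    (hK : ∀ n, volume {y : I | (K : ℕ∞) < (f n ⁻¹' {y}).encard} = 0)
    (hnull : ∀ n, ∀ A : Set ℝ, volume A = 0 → volume {x : I | (f n x : ℝ) ∈ A} = 0)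
    (hlt : ∀ n, ∀ᵐ x : I, ‖g n x‖₊ < (overlapNumber f : ℝ≥0)⁻¹ *
      ((K : ℝ≥0)⁻¹ * ‖approxDeriv (fun y : I => (f n y : ℝ)) x‖₊)) :
    ContractiveSystem f g
      (fun n x => (K : ℝ≥0)⁻¹ * ‖approxDeriv (fun y : I => (f n y : ℝ)) x‖₊)
      (overlapNumber f) volume volume where
  isSubJacobian n := by
    refine isSubJacobian_approxDeriv (hf n) (hd n).1 ((hlt n).mono fun x hx h0 => ?_) (hd n).2
      (hK n) (hnull n)
    simp [h0] at hx
  aestronglyMeasurable n := (hg n).aemeasurable.aestronglyMeasurable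
  nnnorm_le n := (hlt n).mono fun _ => le_of_lt
  encard_le := ae_encard_le_overlapNumber f

theorem mainTheorem3 (N K : ℕ) (hK : 0 < K)
    (f : Fin N → I → I) (g : Fin N → I → ℝ)
    (hf : ∀ n, NullMeasurable (f n) volume)
    (hg : ∀ n, NullMeasurable (g n) volume)
    (H1 : ∀ n, (∀ᵐ x : I, ApproxDifferentiableAt (fun y : I => (f n y : ℝ)) x) ∧ LuzinN (f n))
    (H2 : ∀ n, volume {y : I | (K : ℕ∞) < (f n ⁻¹' {y}).encard} = 0)
    (H3 : ∀ n, ∀ A : Set ℝ, volume A = 0 → volume {x : I | (f n x : ℝ) ∈ A} = 0)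
    (hC1 : ∀ n, ∀ᵐ x : I,
      |g n x| < 1 / ((K : ℝ) * (overlapNumber f : ℝ)) *
        |approxDeriv (fun y : I => (f n y : ℝ)) x|) :
    ∃ P : L1I →L[ℝ] L1I,
      (∀ h : L1I, (P h : I → ℝ) =ᵐ[volume] fun x => ∑ n, g n x * h (f n x)) ∧
      ∀ u : L1I,
        (∀ k : ℕ+, 0 < ‖(P ^ (k : ℕ)) u‖) →
        ∀ (m : Fin N) (C : ℝ), C < 1 →
          (∀ᵐ x : I,
            |g m x| ≤ C / ((K : ℝ) * (overlapNumber f : ℝ)) *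
              |approxDeriv (fun y : I => (f m y : ℝ)) x|) →
          0 < (⨅ k : ℕ+, 1 / ‖(P ^ (k : ℕ)) u‖ *
            ∫ x in range (f m), |((P ^ (k : ℕ)) u : L1I) x|) →
          (∃ α : ℝ, 0 < α ∧ α < 1 ∧ ∀ k : ℕ, ‖(P ^ k) u‖ ≤ α ^ k * ‖u‖) ∧
          ∃ φ₀ : L1I, IsElementarySolution P u φ₀ := by
  have hlt := fun n => (hC1 n).mono fun _ => nnnorm_lt_of_abs_lt
  have S := contractiveSystem_approxDeriv hf hg H1 H2 H3 hlt
  obtain ⟨P, hP⟩ := S.exists_continuousLinearMap (E := ℝ)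
  refine ⟨P, hP, fun u hu m C hC hm hinf => ?_⟩
  obtain ⟨δ, hδ, hmass⟩ := exists_pos_mul_le_of_iInf_div_pos hu
    (fun k => integral_nonneg fun x => abs_nonneg _) hinf
  obtain ⟨α, hα0, hα1, hα⟩ := S.exists_norm_pow_apply_le hlt hP (norm_pos_iff.1 (hu 1))
    (Real.toNNReal_lt_one.2 hC) (hm.mono fun _ => nnnorm_le_of_abs_le) hδ
    fun k => hmass k.succPNat
  exact ⟨⟨α, hα0, hα1, hα⟩, exists_tendsto_sum_pow_apply hα0.le hα1 hα⟩
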